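/- Let $\tau$ be a symbol denoting the unobservable action. For a finite set $A$ of action symbols with $\tau\notin A$ put $A_\tau = A\cup\{\tau\}$. An $A_\tau$-labelled transition system is a quadruple $T=(S,\to,\uparrow,\downarrow)$ with a set of states $S$, a transition relation $\to\ \subseteq S\times A_\tau\times S$, an initial state $\uparrow\ \in S$ and a set of final states $\downarrow\ \subseteq S$. (It need not be finitely branching.) It is *effective* if there are injective codings $S\to\mathbb N$ and $A_\tau\to\mathbb N$ under which the sets $\to$ and $\downarrow$ become recursively enumerable. Write $\twoheadrightarrow$ for the reflexive-transitive closure of $\xrightarrow{\tau}$, and $s\xrightarrow{(a)}t$ if $s\xrightarrow{a}t$, or $a=\tau$ and $s=t$. A *branching bisimulation* from $T_1$ to $T_2$ is a relation $R\subseteq S_1\times S_2$ such that $s_1\mathrel R s_2$ implies: (1) if $s_1\xrightarrow{a}s_1'$, then there are $s_2'',s_2'$ with $s_2\twoheadrightarrow s_2''\xrightarrow{(a)}s_2'$, $s_1\mathrel R s_2''$ and $s_1'\mathrel R s_2'$; (2) if $s_2\xrightarrow{a}s_2'$, then there are $s_1'',s_1'$ with $s_1\twoheadrightarrow s_1''\xrightarrow{(a)}s_1'$,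 $s_1''\mathrel R s_2$ and $s_1'\mathrel R s_2'$; (3) if $s_1$ is final, then there is a final $s_2'$ with $s_2\twoheadrightarrow s_2'$ and $s_1\mathrel R s_2'$; (4) if $s_2$ is final, then there is a final $s_1'$ with $s_1\twoheadrightarrow s_1'$ and $s_1'\mathrel R s_2$. $T_1$ and $T_2$ are *branching bisimilar* if some branching bisimulation from $T_1$ to $T_2$ relates their initial states. Let $D$ be a finite set of data symbols and $D_\square=D\cup\{\square\}$ with a blank $\square\notin D$. A *reactive Turing machine* (RTM) over $A$ and $D$ consists of a finite set $Q$ of states, a transition relation contained in $Q\times D_\square\times A_\tau\times D_\square\times\{L,R\}\times Q$, an initial state in $Q$ and a set of final states contained in $Q$. Its associated transition system has as states the configurations, i.e. pairs of a state in $Q$ and a two-way infinite tape over $D_\square$ with a head position and with all but finitely many cells blank (tapes are taken relative to the head position). A configuration with state $q$ in which the head reads $d$ has an $a$-labelled transition to the configuration obtained by replacing $d$ by $e$, moving the head one cell in direction $M$ and passing to state $q'$, for each transition $(q,d,a,e,M,q')$ of the RTM, and no others. The initial configuration consists of the initial state and the blank tape; a configuration is final if its state is. **Theorem.** There is a finite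 set $D$ of data symbols such that for every finite set $A$ of action symbols and every effective $A_\tau$-labelled transition system $T$ there is an RTM over $A$ and $D$ whose associated transition system is branching bisimilar to $T$. -/

import Mathlib

namespace ReactiveTM

/-- An `Act ∪ {τ}`-labelled transition system with set of states `S`.
Labels are elements of `Option Act`; `none` is the unobservable action `τ`. -/
structure LTS (Act : Type*) (S : Type*) where
  trans : S → Option Act → S → Prop
  init : S
  final : Set S

namespace LTS

variable {Act S S₁ S₂ : Type*}

/-- The reflexive-transitive closure of the `τ`-labelled transitions. -/
def TauSteps (T : LTS Act S) : S → S → Prop :=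
  Relation.ReflTransGen fun s t => T.trans s none t

/-- An `a`-labelled transition, or nothing at all in case `a = τ`. -/
def OptStep (T : LTS Act S) (s : S) (a : Option Act) (t : S) : Prop :=
  T.trans s a t ∨ (a = none ∧ s = t)

/-- Branching bisimulations from `T₁` to `T₂`. -/
structure IsBranchingBisimulation (T₁ : LTS Act S₁) (T₂ : LTS Act S₂)
    (R : S₁ → S₂ → Prop) : Prop where
  forth : ∀ s₁ s₂, R s₁ s₂ → ∀ a s₁', T₁.trans s₁ a s₁' →
    ∃ s₂'' s₂', T₂.TauSteps s₂ s₂'' ∧ T₂.OptStep s₂'' a s₂' ∧ R s₁ s₂'' ∧ R s₁' s₂'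
  back : ∀ s₁ s₂, R s₁ s₂ → ∀ a s₂', T₂.trans s₂ a s₂' →
    ∃ s₁'' s₁', T₁.TauSteps s₁ s₁'' ∧ T₁.OptStep s₁'' a s₁' ∧ R s₁'' s₂ ∧ R s₁' s₂'
  final_forth : ∀ s₁ s₂, R s₁ s₂ → s₁ ∈ T₁.final →
    ∃ s₂', T₂.TauSteps s₂ s₂' ∧ R s₁ s₂' ∧ s₂' ∈ T₂.final
  final_back : ∀ s₁ s₂, R s₁ s₂ → s₂ ∈ T₂.final →
    ∃ s₁', T₁.TauSteps s₁ s₁' ∧ R s₁' s₂ ∧ s₁' ∈ T₁.final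

/-- Two transition systems are branching bisimilar if some branching bisimulation
relates their initial states. -/
def BranchingBisimilar (T₁ : LTS Act S₁) (T₂ : LTS Act S₂) : Prop :=
  ∃ R : S₁ → S₂ → Prop, IsBranchingBisimulation T₁ T₂ R ∧ R T₁.init T₂.init

/-- A transition system is effective if, for some codings of labels and states as natural
numbers (arbitrary injections), the set of its transitions and the set of its final states
are recursively enumerable. -/
def Effective (T : LTS Act S) : Prop :=
  ∃ (codeAct : Option Act → ℕ) (codeState : S → ℕ),
    Function.Injective codeAct ∧ Function.Injective codeState ∧
    REPred (fun p : ℕ × ℕ × ℕ =>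
      ∃ s a t, T.trans s a t ∧ p = (codeState s, codeAct a, codeState t)) ∧
    REPred (fun n : ℕ => ∃ s ∈ T.final, n = codeState s)

end LTS

/-- A reactive Turing machine with action symbols `Act` and data symbols `D`.
Tape symbols are elements of `Option D`; `none` is the blank. The proposition
`trans s d a e m t` says that in state `s`, reading `d`, the machine may execute `a`,
write `e`, move the head in direction `m`, and end up in state `t`. -/
structure RTM (Act : Type*) (D : Type*) where
  State : Type
  finite_state : Finite State
  trans : State → Option D → Option Act → Option D → Turing.Dir → State → Prop
  init : State
  final : Set State

/-- A configuration: a state and a two-way infinite tape with a head position, all but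
finitely many cells of which are blank. -/
abbrev RTM.Config {Act D : Type*} (M : RTM Act D) : Type _ :=
  M.State × Turing.Tape (Option D)

/-- The transition system associated with a reactive Turing machine. Initially, the tape is
blank; a configuration is final if its state is. -/
def RTM.lts {Act D : Type*} (M : RTM Act D) : LTS Act M.Config where
  trans c a c' := ∃ e m, M.trans c.1 c.2.head a e m c'.1 ∧ c'.2 = (c.2.write e).move m
  init := (M.init, Turing.Tape.mk₁ [])
  final := {c | c.1 ∈ M.final}

end ReactiveTM

namespace ReactiveTM

open Turing.PartrecToTM2 (K')
open Turing StateTransition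

/-! A recursively enumerable set is the projection of a primitive recursive one
(`exists_primrec_of_rePred`). So `s` has an `a`-transition to `t` iff a total test accepts the codes
of `s`, `a`, `t` together with some witness `w`. A candidate `k` packs a padding, a target code and
a witness. Between phases the tape holds `enc n k`, where `n` is the code of the current state.
After each phase the machine chooses freely: increment `k`, test `k` for some label or for finality,
or, after a successful test for `a`, perform `a` and replace `n` by the target of `k`.

Every step but the last kind is inert. Each phase terminates, and from any configuration belonging
to `n` all sufficiently large candidates can still be tested (`exists_tauSteps_check`). By padding,
each transition has arbitrarily large candidates (`exists_candidate`), so the search never discards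
an option, even under infinite branching. Searching forever is harmless, since branching
bisimilarity ignores divergence. `branchingBisimilar_searchRTM` assembles this.

The data symbols do not depend on `T`: the phases are run by Mathlib's evaluator for partial
recursive functions, whose single-tape alphabet is fixed. Only the finite set of control states
depends on the codes evaluated (`exists_finite_support`). A phase returns `2 * enc n k + b`. Popping
the lowest bit moves `b` into the finite control and leaves `enc n k` as the input of the next phase
(`machine_reaches`). -/

/-! ### A Turing machine evaluating codes and splitting off the parity of the result -/

/-- Stack symbols of the program for partial recursive functions. -/
abbrev StackSym := (PartrecToTM2.Γ' : Type)

/-- Statements of the stack program for partial recursive functions. -/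
abbrev StackStmt : Type :=
  TM2.Stmt (fun _ : K' => StackSym) PartrecToTM2.Λ' (Option StackSym)

/-- The stack program for partial recursive functions, which instead of halting right after the
evaluation first pops the topmost symbol of the result into the local store. -/
def popTr (q : PartrecToTM2.Λ') : StackStmt :=
  if q = .ret .halt then .pop .main (fun _ x => x) .halt else PartrecToTM2.tr q

theorem popTr_ret_halt : popTr (.ret .halt) = .pop .main (fun _ x => x) .halt := if_pos rfl

theorem popTr_of_ne {q : PartrecToTM2.Λ'} (hq : q ≠ .ret .halt) : popTr q = PartrecToTM2.tr q :=
  if_neg hq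

/-- Tape symbols of the evaluating Turing machine. -/
abbrev Sym : Type := TM2to1.Γ' K' fun _ => StackSym

instance : Finite K' :=
  Finite.of_surjective (fun i : Fin 4 => ![K'.main, .rev, .aux, .stack] i) fun k => by
    cases k
    exacts [⟨0, rfl⟩, ⟨1, rfl⟩, ⟨2, rfl⟩, ⟨3, rfl⟩]

instance : Finite Sym := inferInstanceAs (Finite (Bool × (K' → Option StackSym)))

/-- Labels of the evaluating program. -/
abbrev Lbl : Type := TM2to1.Λ' K' (fun _ => StackSym) PartrecToTM2.Λ' (Option StackSym)

/-- Control states of the evaluating Turing machine. -/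
abbrev Ctl : Type := Option (TM1.Stmt Sym Lbl (Option StackSym)) × Option StackSym

/-- The single-tape program simulating `popTr`. -/
def prog : Lbl → TM1.Stmt Sym Lbl (Option PartrecToTM2.Γ') := TM2to1.tr popTr

/-- The evaluating Turing machine. -/
def machine : Ctl → Sym → Option (Ctl × TM0.Stmt Sym) := TM1to0.tr prog

/-- The control state in which the evaluation of `c` starts. -/
def startCtl (c : ToPartrec.Code) : Ctl :=
  (some (prog (.normal (PartrecToTM2.trNormal c .halt))), none)

/-- The control state in which an evaluation stops, having popped the bit `b`. -/
def haltCtl (b : Bool) : Ctl := (none, some (if b then .bit1 else .bit0))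

/-- A step of the evaluating Turing machine. -/
def mstep (c : Ctl × Tape Sym) : Option (Ctl × Tape Sym) :=
  (machine c.1 c.2.head).map fun r => (r.1, match r.2 with
    | .move d => c.2.move d
    | .write a => c.2.write a)

/-- The tape represents the list `v`. -/
def Represents (v : List ℕ) (T : Tape Sym) : Prop :=
  ∃ L : ListBlank (∀ _ : K', Option PartrecToTM2.Γ'),
    (∀ k, L.map (proj k) =
      ListBlank.mk ((PartrecToTM2.K'.elim (PartrecToTM2.trList v) [] [] [] k).map some).reverse) ∧
    T = Tape.mk' ∅ (TM2to1.addBottom L)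

theorem represents_nil :
    Represents [] ((Tape.mk₁ []).write ((true, fun _ => none) : Sym)) := by
  refine ⟨ListBlank.mk [], fun k => ?_, ?_⟩
  · cases k <;> rfl
  · rfl

/-- A statement that always ends in a jump. -/
def NeverHalts : StackStmt → Prop
  | .push _ _ q | .peek _ _ q | .pop _ _ q | .load _ q => NeverHalts q
  | .branch _ q₁ q₂ => NeverHalts q₁ ∧ NeverHalts q₂
  | .goto _ => True
  | .halt => False

theorem NeverHalts.label_ne_none {q : StackStmt} (h : NeverHalts q) (s S) :
    (TM2.stepAux q s S).l ≠ none := by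
  induction q generalizing s S with
  | push _ _ _ ih | peek _ _ _ ih | pop _ _ _ ih | load _ _ ih => exact ih h _ _
  | branch p q₁ q₂ ih₁ ih₂ =>
    rw [TM2.stepAux]
    cases p s
    · exact ih₂ h.2 _ _
    · exact ih₁ h.1 _ _
  | goto => exact Option.some_ne_none _
  | halt => exact h.elim

theorem neverHalts_tr {q : PartrecToTM2.Λ'} (hq : q ≠ .ret .halt) :
    NeverHalts (PartrecToTM2.tr q) := by
  rcases q with _ | _ | _ | _ | _ | _ | _ | (_ | _ | _ | _ | _)
  all_goals first
    | exact absurd rfl hq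
    | exact trivial
    | exact ⟨trivial, trivial⟩
    | exact ⟨trivial, trivial, trivial⟩
    | exact ⟨trivial, trivial, trivial, trivial⟩

/-- By `neverHalts_tr` the original program can halt only at `.ret .halt`, and before that point the
two programs agree. -/
theorem reaches_ret_halt {c d : PartrecToTM2.Cfg'} (h : Reaches (TM2.step PartrecToTM2.tr) c d)
    (hc : c.l ≠ none) (hd : d.l = none) :
    ∃ s, Reaches (TM2.step popTr) c ⟨some (.ret .halt), s, d.stk⟩ := by
  induction h using Relation.ReflTransGen.head_induction_on with
  | refl => exact absurd hd hc
  | @head c e hce hed ih =>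
    obtain ⟨_ | q, s, S⟩ := c
    · exact absurd rfl hc
    by_cases hq : q = .ret .halt
    · subst hq
      refine ⟨s, ?_⟩
      -- At `.ret .halt` only the local store is cleared, so the stacks are already those of `d`.
      have he : e = ⟨none, none, S⟩ := by
        exact (Option.some.inj hce).symm
      subst he
      have : d = ⟨none, none, S⟩ := by
        rcases Relation.ReflTransGen.cases_head hed with h | ⟨f, hf, -⟩
        · exact h.symm
        · cases hf
      subst this
      exact .refl
    · have he : e = TM2.stepAux (PartrecToTM2.tr q) s S := by
        exact (Option.some.inj hce).symm
      obtain ⟨s', h'⟩ := ih (by rw [he]; exact (neverHalts_tr hq).label_ne_none s S)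
      refine ⟨s', .head ?_ h'⟩
      rw [he, ← popTr_of_ne hq]
      rfl

/-- Numerals are stored with the lowest bit on top. Zero is the empty numeral, so `z = 0`, `b =
false` would leave no bit to pop. -/
theorem trNat_two_mul_add {z : ℕ} (hz : 0 < z) (b : Bool) :
    PartrecToTM2.trNat (2 * z + b.toNat) =
      (if b then .bit1 else .bit0) :: PartrecToTM2.trNat z := by
  have h : ((2 * z + b.toNat : ℕ) : Num) = if b then (z : Num).bit1 else (z : Num).bit0 := by
    cases b
    · simp [Num.bit0_of_bit0, two_mul]
    · simp [Num.bit1_of_bit1, two_mul]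
  rw [PartrecToTM2.trNat, PartrecToTM2.trNat, h]
  cases hp : (z : Num) with
  | zero =>
    have : (z : Num) = ((0 : ℕ) : Num) := hp
    rw [Num.of_nat_inj] at this
    omega
  | pos p => cases b <;> rfl

theorem popTr_reaches {c : ToPartrec.Code} {v : List ℕ} {z : ℕ} {b : Bool} (hz : 0 < z)
    (h : c.eval v = pure [2 * z + b.toNat]) :
    Reaches (TM2.step popTr) (PartrecToTM2.init c v)
      ⟨none, some (if b then .bit1 else .bit0),
        PartrecToTM2.K'.elim (PartrecToTM2.trList [z]) [] [] []⟩ := by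
  have h₁ : PartrecToTM2.halt [2 * z + b.toNat] ∈
      eval (TM2.step PartrecToTM2.tr) (PartrecToTM2.init c v) := by
    rw [PartrecToTM2.tr_eval, h]
    exact Part.mem_map _ (Part.mem_some _)
  obtain ⟨s, hs⟩ := reaches_ret_halt (mem_eval.1 h₁).1 (by simp [PartrecToTM2.init]) rfl
  refine hs.tail (congrArg some ?_)
  rw [popTr_ret_halt]
  simp only [TM2.stepAux, PartrecToTM2.halt, PartrecToTM2.trList, trNat_two_mul_add hz]
  simp

/-- Transfers `popTr_reaches` along the simulations of stacks by one tape and of structured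
statements by elementary steps. -/
theorem machine_reaches {c : ToPartrec.Code} {v : List ℕ} {z : ℕ} {b : Bool} (hz : 0 < z)
    (h : c.eval v = pure [2 * z + b.toNat]) {T : Tape Sym} (hT : Represents v T) :
    ∃ T', Represents [z] T' ∧ Reaches mstep (startCtl c, T) (haltCtl b, T') := by
  obtain ⟨L, hL, rfl⟩ := hT
  obtain ⟨_, ⟨L', hL'⟩, h₁⟩ := tr_reaches (TM2to1.tr_respects popTr)
    (TM2to1.TrCfg.mk (q := some _) (v := none) L hL) (popTr_reaches hz h)
  obtain ⟨_, rfl, h₂⟩ := tr_reaches (TM1to0.tr_respects prog) rfl h₁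
  refine ⟨_, ⟨L', hL', rfl⟩, ?_⟩
  have := h₂.lift (r := fun a b => b ∈ TM0.step (TM1to0.tr prog) a)
    (p := fun a b => b ∈ mstep a) (fun c : TM0.Cfg Sym Ctl => ((c.q, c.Tape) : Ctl × Tape Sym))
    (by
      rintro ⟨q, T⟩ ⟨q', T'⟩ h
      simp only [TM0.step, Option.mem_def, Option.map_eq_some_iff] at h
      obtain ⟨⟨p, _ | _⟩, hr, h⟩ := h
      all_goals simp only [mstep, Option.mem_def, Option.map_eq_some_iff]
      all_goals
        refine ⟨_, hr, ?_⟩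
        cases h
        rfl)
  exact this

theorem exists_finite_support (c : ToPartrec.Code) :
    ∃ S : Set Ctl, S.Finite ∧ startCtl c ∈ S ∧
      ∀ q a q' s, machine q a = some (q', s) → q ∈ S → q' ∈ S := by
  -- `Supports` demands that the default label lie in the support, so the start label is made the
  -- default one.
  let i : Inhabited PartrecToTM2.Λ' := ⟨PartrecToTM2.trNormal c .halt⟩
  have h₂ : TM2.Supports popTr (PartrecToTM2.codeSupp c .halt) := by
    obtain ⟨h₁, h₂⟩ := PartrecToTM2.tr_supports c .halt
    refine ⟨h₁, fun q hq => ?_⟩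
    by_cases h : q = .ret .halt
    · subst h
      rw [popTr_ret_halt]
      exact trivial
    · rw [popTr_of_ne h]
      exact h₂ q hq
  obtain ⟨h, h'⟩ := TM1to0.tr_supports _ (TM2to1.tr_supports popTr h₂)
  exact ⟨_, Finset.finite_toSet _, h, fun q a q' s hq hS => h' hq hS⟩

/-! ### Recursively enumerable predicates and codes of computable functions -/

/-- The witness `w` bounds the evaluation: `evaln w` is total and primitive recursive. -/
theorem exists_primrec_of_rePred {α : Type*} [Primcodable α] {p : α → Prop} (h : REPred p) :
    ∃ f : α → ℕ → Bool, Primrec₂ f ∧ ∀ a, p a ↔ ∃ w, f a w = true := by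
  obtain ⟨c, hc⟩ := Nat.Partrec.Code.exists_code.1 h
  refine ⟨fun a w => (Nat.Partrec.Code.evaln w c (Encodable.encode a)).isSome, ?_, fun a => ?_⟩
  · exact Primrec.option_isSome.comp (Nat.Partrec.Code.primrec_evaln.comp
      ((Primrec.snd.pair (Primrec.const c)).pair (Primrec.encode.comp Primrec.fst)))
  · have h₁ : p a ↔ ∃ x, x ∈ c.eval (Encodable.encode a) := by
      rw [hc]
      simp
    simp_rw [h₁, Nat.Partrec.Code.evaln_complete, Option.isSome_iff_exists]
    exact exists_comm

theorem exists_code_of_computable {f : ℕ → ℕ} (hf : Computable f) :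
    ∃ c : ToPartrec.Code, ∀ x, c.eval [x] = pure [f x] := by
  obtain ⟨c, hc⟩ := ToPartrec.Code.exists_code (Nat.Partrec'.part_iff₁.2 hf)
  refine ⟨c, fun x => ?_⟩
  rw [show [x] = (x ::ᵥ .nil : List.Vector ℕ 1).1 from rfl, hc]
  exact Part.map_some _ _

theorem exists_code_const (y : ℕ) : ∃ c : ToPartrec.Code, c.eval [] = pure [y] := by
  obtain ⟨c, hc⟩ := ToPartrec.Code.exists_code
    (Nat.Partrec'.part_iff.2 (Computable.const (α := List.Vector ℕ 0) y))
  refine ⟨c, ?_⟩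
  rw [show [] = (.nil : List.Vector ℕ 0).1 from rfl, hc]
  exact Part.map_some _ _

/-! ### Searching for transitions -/

/-- The code of the state `n` together with the candidate `k`. -/
def enc (n k : ℕ) : ℕ := Nat.pair n k + 1

/-- Positivity guarantees that the doubled value has a lowest bit to pop. -/
theorem enc_pos (n k : ℕ) : 0 < enc n k := Nat.succ_pos _

/-- The state proposed by a candidate. -/
def target (k : ℕ) : ℕ := k.unpair.2.unpair.1

/-- The witness proposed by a candidate. -/
def witness (k : ℕ) : ℕ := k.unpair.2.unpair.2

/-- The first component of the pair is pure padding: it makes `k` large without affecting target or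
witness. -/
theorem exists_candidate (t w K : ℕ) : ∃ k, K ≤ k ∧ target k = t ∧ witness k = w :=
  ⟨Nat.pair K (Nat.pair t w), Nat.left_le_pair _ _, by simp [target], by simp [witness]⟩

/-- The phases of the simulation: setting up the tape, proceeding to the next candidate, moving
to the state proposed by the candidate, and testing the candidate. -/
inductive Phase (ι : Type)
  | boot
  | inc
  | go
  | check (l : ι)

instance (ι : Type) [Finite ι] : Finite (Phase ι) :=
  Finite.of_surjective (fun x : Option (Option (Option ι)) => match x with
    | none => Phase.boot
    | some none => .inc
    | some (some none) => .go
    | some (some (some l)) => .check l) fun p => by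
      cases p
      exacts [⟨none, rfl⟩, ⟨some none, rfl⟩, ⟨some (some none), rfl⟩, ⟨some (some (some _)), rfl⟩]

/-- `Run n₀ test p v n k b` says that on input `v` the phase `p` results in the state `n`, the
candidate `k` and the bit `b`. -/
inductive Run {ι : Type} (n₀ : ℕ) (test : ι → ℕ → ℕ → Bool) :
    Phase ι → List ℕ → ℕ → ℕ → Bool → Prop
  | boot : Run n₀ test .boot [] n₀ 0 false
  | inc (n k : ℕ) : Run n₀ test .inc [enc n k] n (k + 1) false
  | go (n k : ℕ) : Run n₀ test .go [enc n k] (target k) 0 false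
  | check (l : ι) (n k : ℕ) : Run n₀ test (.check l) [enc n k] n k (test l n k)

theorem Run.test_eq {ι : Type} {n₀ : ℕ} {test : ι → ℕ → ℕ → Bool} {l : ι} {v : List ℕ} {n k : ℕ}
    {b : Bool} (h : Run n₀ test (.check l) v n k b) : test l n k = b := by
  cases h
  rfl

theorem exists_codes {ι : Type} (n₀ : ℕ) {test : ι → ℕ → ℕ → Bool} (h : ∀ l, Primrec₂ (test l)) :
    ∃ cd : Phase ι → ToPartrec.Code, ∀ p v n k b, Run n₀ test p v n k b →
      (cd p).eval v = pure [2 * enc n k + b.toNat] := by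
  have hp : Primrec fun x : ℕ => (x - 1).unpair := Primrec.unpair.comp Primrec.pred
  have h2 : Primrec fun x : ℕ => 2 * x := Primrec.nat_mul.comp (Primrec.const 2) Primrec.id
  have henc : Primrec₂ enc := Primrec.succ.comp Primrec₂.natPair
  have htarget : Primrec target :=
    Primrec.fst.comp (Primrec.unpair.comp (Primrec.snd.comp Primrec.unpair))
  obtain ⟨cb, hcb⟩ := exists_code_const (2 * enc n₀ 0)
  obtain ⟨ci, hci⟩ := exists_code_of_computable (h2.comp (henc.comp (Primrec.fst.comp hp)
    (Primrec.succ.comp (Primrec.snd.comp hp)))).to_comp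
  obtain ⟨cg, hcg⟩ := exists_code_of_computable (h2.comp (henc.comp
    (htarget.comp (Primrec.snd.comp hp)) (Primrec.const 0))).to_comp
  have hb : Primrec Bool.toNat := Primrec.dom_finite _
  choose cc hcc using fun l => exists_code_of_computable (Primrec.nat_add.comp h2
    (hb.comp ((h l).comp (Primrec.fst.comp hp) (Primrec.snd.comp hp)))).to_comp
  refine ⟨fun p => match p with
    | .boot => cb
    | .inc => ci
    | .go => cg
    | .check l => cc l, fun p v n k b hr => ?_⟩
  cases hr with
  | boot => exact hcb
  | inc => simp [hci, enc]
  | go => simp [hcg, enc]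
  | check => simp [hcc, enc]

/-! ### The reactive Turing machine -/

/-- Tape symbols of the evaluating machine as tape symbols of the reactive machine. -/
noncomputable def toCell : PointedMap Sym (Option Sym) := by
  classical exact ⟨fun x => if x = default then none else some x, if_pos rfl⟩

/-- Tape symbols of the reactive machine as tape symbols of the evaluating machine. -/
def ofCell (d : Option Sym) : Sym := d.getD default

theorem ofCell_toCell (x : Sym) : ofCell (toCell x) = x := by
  classical
  change ofCell (if x = default then none else some x) = x
  split_ifs with h
  · exact h.symm
  · rfl

section

variable {Act : Type*} {P : Type} {S : Set Ctl}

/-- The transitions of a reactive Turing machine that runs the evaluating machine in phases. The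
flag in a state indicates that the head has to move back to the left first. The initial state
`none` marks the bottom of the stacks. -/
inductive PhaseStep (next : P → Bool → Option Act → P → Prop) (boot : P) (start : P → S) :
    Option (P × Bool × S) → Option Sym → Option Act → Option Sym → Dir → Option (P × Bool × S) →
      Prop
  | boot (d) : PhaseStep next boot start none d none (toCell (true, fun _ => none)) .right
      (some (boot, true, start boot))
  | back (p q d) : PhaseStep next boot start (some (p, true, q)) d none d .left
      (some (p, false, q))
  | move (p q q' d m) : machine q.1 (ofCell d) = some (q'.1, .move m) →
      PhaseStep next boot start (some (p, false, q)) d none d m (some (p, false, q'))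
  | write (p q q' d x) : machine q.1 (ofCell d) = some (q'.1, .write x) →
      PhaseStep next boot start (some (p, false, q)) d none (toCell x) .right (some (p, true, q'))
  | next (p q d b a p₂) : q.1 = haltCtl b → next p b a p₂ →
      PhaseStep next boot start (some (p, false, q)) d a d .right (some (p₂, true, start p₂))

/-- The reactive Turing machine that runs the evaluating machine in phases. -/
def phaseRTM [Finite P] [Finite S] (next : P → Bool → Option Act → P → Prop)
    (accept : P → Bool → Prop) (boot : P) (start : P → S) : RTM Act Sym where
  State := Option (P × Bool × S)
  finite_state := inferInstance
  trans := PhaseStep next boot start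
  init := none
  final := {c | ∃ p q b, c = some (p, false, q) ∧ q.1 = haltCtl b ∧ accept p b}

variable [Finite P] [Finite S] (next : P → Bool → Option Act → P → Prop)
    (accept : P → Bool → Prop) (boot : P) (start : P → S)

/-- The configuration of the reactive machine in which the evaluating machine has control state
`q` and tape `T`. -/
noncomputable def conf (p : P) (r : Bool) (q : S) (T : Tape Sym) :
    (phaseRTM next accept boot start).Config :=
  (some (p, r, q), (if r then T.move .right else T).map toCell)

variable {next accept boot start}

theorem trans_conf_true (p : P) (q : S) (T : Tape Sym) :
    (phaseRTM next accept boot start).lts.trans (conf next accept boot start p true q T) none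
      (conf next accept boot start p false q T) := by
  refine ⟨_, .left, .back p q _, ?_⟩
  simp only [conf, Tape.write_self, if_true, ← Tape.map_move, Tape.move_right_left]
  rfl

theorem trans_init :
    (phaseRTM next accept boot start).lts.trans (phaseRTM next accept boot start).lts.init none
      (conf next accept boot start boot true (start boot)
        ((Tape.mk₁ []).write (true, fun _ => none))) := by
  refine ⟨_, .right, .boot _, ?_⟩
  simp only [conf, if_true, Tape.map_move]
  rfl

theorem trans_next {p p' : P} {q : S} {b : Bool} {a : Option Act} (hq : q.1 = haltCtl b)
    (h : next p b a p') (T : Tape Sym) :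
    (phaseRTM next accept boot start).lts.trans (conf next accept boot start p false q T) a
      (conf next accept boot start p' true (start p') T) := by
  refine ⟨_, .right, .next p q _ b a p' hq h, ?_⟩
  simp only [conf, Tape.write_self, if_true, Tape.map_move]
  rfl

/-- A reactive machine must move whenever it writes, so a stationary write becomes a write with a
move right, followed by a move back. -/
theorem tauSteps_of_mstep (p : P) {q q' : S} {T T' : Tape Sym}
    (h : mstep (q.1, T) = some (q'.1, T')) :
    (phaseRTM next accept boot start).lts.TauSteps (conf next accept boot start p false q T)
      (conf next accept boot start p false q' T') := by
  simp only [mstep, Option.map_eq_some_iff] at h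
  obtain ⟨⟨x, m | x⟩, h, h'⟩ := h
  all_goals
    obtain ⟨rfl, rfl⟩ := Prod.mk.inj h'
  · refine .single ⟨_, m, .move p q q' _ m ?_, ?_⟩
    · change machine q.1 (ofCell (T.map toCell).head) = _
      rw [Tape.map_fst, ofCell_toCell, h]
    · simp only [conf, Tape.write_self, Bool.false_eq_true, if_false, Tape.map_move]
  · refine .head (b := conf next accept boot start p true q' (T.write x))
      ⟨_, .right, .write p q q' _ x ?_, ?_⟩ (.single (trans_conf_true p q' _))
    · change machine q.1 (ofCell (T.map toCell).head) = _
      rw [Tape.map_fst, ofCell_toCell, h]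
    · simp only [conf, if_true, Tape.map_move, Tape.map_write]
      rfl

theorem tauSteps_of_reaches
    (hS : ∀ q a q' s, machine q a = some (q', s) → q ∈ S → q' ∈ S) (p : P) {q : S} {q' : Ctl}
    {T T' : Tape Sym} (h : Reaches mstep (q.1, T) (q', T')) :
    ∃ hq : q' ∈ S,
      (phaseRTM next accept boot start).lts.TauSteps (conf next accept boot start p false q T)
        (conf next accept boot start p false ⟨q', hq⟩ T') := by
  generalize hd : (q', T') = d at h
  induction h generalizing q' T' with
  | refl => cases hd; exact ⟨q.2, .refl⟩
  | @tail c d _ hcd ih =>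
    subst hd
    obtain ⟨hq, h⟩ := ih rfl
    have hq' : q' ∈ S := by
      obtain ⟨⟨x, s⟩, hx, h'⟩ := Option.map_eq_some_iff.1 hcd
      cases h'
      exact hS _ _ _ _ hx hq
    exact ⟨hq', h.trans (tauSteps_of_mstep p (q := ⟨c.1, hq⟩) (q' := ⟨q', hq'⟩) hcd)⟩

/-- The transitions of the reactive machine out of a configuration `conf p r q T`. -/
theorem trans_conf_cases {p : P} {r : Bool} {q : S} {T : Tape Sym} {a : Option Act}
    {c : (phaseRTM next accept boot start).Config}
    (h : (phaseRTM next accept boot start).lts.trans (conf next accept boot start p r q T) a c) :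
    (a = none ∧ c = conf next accept boot start p false q T) ∨
    (a = none ∧ ∃ r' q' T', mstep (q.1, T) = some (q'.1, T') ∧
      c = conf next accept boot start p r' q' T') ∨
    ∃ b p', q.1 = haltCtl b ∧ next p b a p' ∧
      c = conf next accept boot start p' true (start p') T := by
  obtain ⟨c, T'⟩ := c
  obtain ⟨e, m, h, hT⟩ := h
  simp only at hT
  subst hT
  generalize hs : (conf next accept boot start p r q T).1 = s at h
  generalize hd : (conf next accept boot start p r q T).2.head = d at h
  simp only at h
  cases h with
  | boot => cases hs
  | back =>
    cases hs
    subst hd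
    refine .inl ⟨rfl, ?_⟩
    simp only [conf, Tape.write_self, if_true, ← Tape.map_move, Tape.move_right_left]
    rfl
  | move _ _ q' _ m h =>
    cases hs
    subst hd
    refine .inr (.inl ⟨rfl, false, q', T.move m, ?_, ?_⟩)
    · change machine q.1 (ofCell (T.map toCell).head) = _ at h
      rw [Tape.map_fst, ofCell_toCell] at h
      simp [mstep, h]
    · simp only [conf, Tape.write_self, Bool.false_eq_true, if_false, Tape.map_move]
  | write _ _ q' _ x h =>
    cases hs
    subst hd
    refine .inr (.inl ⟨rfl, true, q', T.write x, ?_, ?_⟩)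
    · change machine q.1 (ofCell (T.map toCell).head) = _ at h
      rw [Tape.map_fst, ofCell_toCell] at h
      simp [mstep, h]
    · simp only [conf, if_true, Tape.map_move, Tape.map_write]
      rfl
  | next _ _ _ b _ p' hq hn =>
    cases hs
    subst hd
    refine .inr (.inr ⟨b, p', hq, hn, ?_⟩)
    simp only [conf, Tape.write_self, if_true, Tape.map_move]
    rfl

theorem trans_init_cases {a : Option Act} {c : (phaseRTM next accept boot start).Config}
    (h : (phaseRTM next accept boot start).lts.trans
      (phaseRTM next accept boot start).lts.init a c) :
    a = none ∧ c = conf next accept boot start boot true (start boot)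
        ((Tape.mk₁ []).write (true, fun _ => none)) := by
  obtain ⟨c, T'⟩ := c
  obtain ⟨e, m, h, hT⟩ := h
  simp only at hT
  subst hT
  generalize hs : ((phaseRTM next accept boot start).lts.init).1 = s at h
  cases h with
  | boot =>
    refine ⟨rfl, ?_⟩
    simp only [conf, if_true, Tape.map_move]
    rfl
  | _ => cases hs

end

/-! ### The branching bisimulation -/

/-- The choices available after a phase: continue the search in any way, or, if a candidate for a
transition passed its test, perform this transition. -/
def Next {Act : Type*} {ι : Type} (lab : Option Act → Option ι) (p : Phase (Option ι)) (b : Bool)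
    (a : Option Act) (p' : Phase (Option ι)) : Prop :=
  (a = none ∧ (p' = .inc ∨ ∃ l, p' = .check l)) ∨ (b = true ∧ p = .check (lab a) ∧ p' = .go)

/-- A state is accepting if the test for finality succeeded. -/
def Accept {ι : Type} (p : Phase (Option ι)) (b : Bool) : Prop := p = .check none ∧ b = true

/-- The reactive Turing machine searching for transitions. -/
def searchRTM {Act : Type*} {ι : Type} [Finite ι] {Q : Set Ctl} [Finite Q]
    (lab : Option Act → Option ι) (start : Phase (Option ι) → Q) : RTM Act Sym :=
  phaseRTM (Next lab) Accept .boot start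

section

variable {Act S : Type*} {ι : Type} [Finite ι] {Q : Set Ctl} [Finite Q]

/-- The configuration of `searchRTM` in which the evaluating machine has control state `q` and
tape `T`. -/
noncomputable def sconf (lab : Option Act → Option ι) (start : Phase (Option ι) → Q)
    (p : Phase (Option ι)) (r : Bool) (q : Q) (T : Tape Sym) : (searchRTM lab start).Config :=
  conf (Next lab) Accept .boot start p r q T

/-- The configuration `c` occurs in a run of a phase that results in the state `n`. -/
def Within (lab : Option Act → Option ι) (start : Phase (Option ι) → Q) (n₀ : ℕ)
    (test : Option ι → ℕ → ℕ → Bool) (n : ℕ) (c : (searchRTM lab start).Config) : Prop :=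
  ∃ p v k b T₀ r q T, Run n₀ test p v n k b ∧ Represents v T₀ ∧
    Reaches mstep ((start p).1, T₀) (q.1, T) ∧ c = sconf lab start p r q T

variable {lab : Option Act → Option ι} {start : Phase (Option ι) → Q} {n₀ : ℕ}
  {test : Option ι → ℕ → ℕ → Bool} {cd : Phase (Option ι) → ToPartrec.Code}

theorem within_start {p : Phase (Option ι)} {v : List ℕ} {n k : ℕ} {b : Bool}
    (h : Run n₀ test p v n k b) {T : Tape Sym} (hT : Represents v T) (r : Bool) :
    Within lab start n₀ test n (sconf lab start p r (start p) T) :=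
  ⟨p, v, k, b, T, r, start p, T, h, hT, .refl, rfl⟩

/-- `mstep` is deterministic and halting configurations have no successor, so each reachable
configuration lies on the path to the halt. -/
theorem reaches_halt_of_reaches {x y : Ctl × Tape Sym} {b : Bool} {T : Tape Sym}
    (hy : Reaches mstep x y) (h : Reaches mstep x (haltCtl b, T)) :
    Reaches mstep y (haltCtl b, T) := by
  rcases reaches_total hy h with h | h
  · exact h
  · rcases Relation.ReflTransGen.cases_head h with h | ⟨z, hz, -⟩
    · exact h ▸ .refl
    · cases hz

theorem eq_of_reaches_halt {b b' : Bool} {T T' : Tape Sym}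
    (h : Reaches mstep (haltCtl b, T) (haltCtl b', T')) : b = b' ∧ T = T' := by
  rcases Relation.ReflTransGen.cases_head h with h | ⟨z, hz, -⟩
  · obtain ⟨h₁, h₂⟩ := Prod.mk.inj h
    refine ⟨?_, h₂⟩
    cases b <;> cases b' <;> first | rfl | cases h₁
  · cases hz

variable (hstart : ∀ p, (start p).1 = startCtl (cd p))
  (hcd : ∀ p v n k b, Run n₀ test p v n k b → (cd p).eval v = pure [2 * enc n k + b.toNat])
  (hQ : ∀ q a q' s, machine q a = some (q', s) → q ∈ Q → q' ∈ Q)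

omit [Finite ι] [Finite Q] in
include hstart hcd in
/-- If the evaluating machine has halted within a run, then the run is complete. -/
theorem represents_of_reaches_halt {p : Phase (Option ι)} {v : List ℕ} {n k : ℕ} {b b' : Bool}
    (h : Run n₀ test p v n k b) {T₀ T : Tape Sym} (hT₀ : Represents v T₀)
    (hr : Reaches mstep ((start p).1, T₀) (haltCtl b', T)) :
    b' = b ∧ Represents [enc n k] T := by
  obtain ⟨T', hT', h'⟩ := machine_reaches (enc_pos n k) (hcd _ _ _ _ _ h) hT₀
  rw [← hstart] at h'
  obtain ⟨rfl, rfl⟩ := eq_of_reaches_halt (reaches_halt_of_reaches hr h')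
  exact ⟨rfl, hT'⟩

include hstart hcd hQ in
/-- Every configuration within a run evolves to a configuration in which the run is complete. -/
theorem tauSteps_halt {p : Phase (Option ι)} {v : List ℕ} {n k : ℕ} {b : Bool}
    (h : Run n₀ test p v n k b) {T₀ T : Tape Sym} (hT₀ : Represents v T₀) {q : Q} (r : Bool)
    (hr : Reaches mstep ((start p).1, T₀) (q.1, T)) :
    ∃ (q' : Q) (T' : Tape Sym), q'.1 = haltCtl b ∧ Represents [enc n k] T' ∧
      (searchRTM lab start).lts.TauSteps (sconf lab start p r q T)
        (sconf lab start p false q' T') ∧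
      Within lab start n₀ test n (sconf lab start p false q' T') := by
  obtain ⟨T', hT', h'⟩ := machine_reaches (enc_pos n k) (hcd _ _ _ _ _ h) hT₀
  rw [← hstart] at h'
  obtain ⟨hq, h₂⟩ := tauSteps_of_reaches (next := Next lab) (accept := Accept) (boot := .boot)
    (start := start) hQ p (reaches_halt_of_reaches hr h')
  refine ⟨⟨_, hq⟩, T', rfl, hT', ?_, ⟨p, v, k, b, T₀, false, _, T', h, hT₀, h', rfl⟩⟩
  cases r
  · exact h₂
  · exact .head (trans_conf_true p q T) h₂

include hstart hcd hQ in
/-- From every configuration belonging to the state `n`, every sufficiently large candidate can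
be tested. -/
theorem exists_tauSteps_check {n : ℕ} {c : (searchRTM lab start).Config}
    (hc : Within lab start n₀ test n c) :
    ∃ K, ∀ k, K ≤ k → ∀ l, ∃ (q : Q) (T : Tape Sym), q.1 = haltCtl (test l n k) ∧
      Represents [enc n k] T ∧
      (searchRTM lab start).lts.TauSteps c (sconf lab start (.check l) false q T) ∧
      Within lab start n₀ test n (sconf lab start (.check l) false q T) := by
  obtain ⟨p, v, K, b, T₀, r, q, T, hrun, hT₀, hr, rfl⟩ := hc
  refine ⟨K, fun k hk l => ?_⟩
  -- `K` is the candidate with which the current run ends. Incrementing is allowed after any phase,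
  -- whatever its bit, so the candidate can be raised from `K` to `k`.
  have key : ∃ (p' : Phase (Option ι)) (b : Bool) (q' : Q) (T' : Tape Sym),
      q'.1 = haltCtl b ∧ Represents [enc n k] T' ∧
      (searchRTM lab start).lts.TauSteps (sconf lab start p r q T)
        (sconf lab start p' false q' T') := by
    induction k, hk using Nat.le_induction with
    | base =>
      obtain ⟨q', T', h₁, h₂, h₃, -⟩ := tauSteps_halt hstart hcd hQ hrun hT₀ r hr
      exact ⟨p, b, q', T', h₁, h₂, h₃⟩
    | succ k _ ih =>
      obtain ⟨p', b, q', T', hq', hT', h⟩ := ih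
      obtain ⟨q₂, T₂, h₁, h₂, h₃, -⟩ := tauSteps_halt hstart hcd hQ
        (Run.inc (n₀ := n₀) (test := test) n k) hT' true .refl
      refine ⟨_, _, q₂, T₂, h₁, h₂, h.trans (.head ?_ h₃)⟩
      exact trans_next hq' (.inl ⟨rfl, .inl rfl⟩) T'
  obtain ⟨p', b, q', T', hq', hT', h⟩ := key
  obtain ⟨q₂, T₂, h₁, h₂, h₃, h₄⟩ := tauSteps_halt hstart hcd hQ
    (Run.check (n₀ := n₀) (test := test) l n k) hT' true .refl
  refine ⟨q₂, T₂, h₁, h₂, h.trans (.head ?_ h₃), h₄⟩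
  exact trans_next hq' (.inl ⟨rfl, .inr ⟨l, rfl⟩⟩) T'

-- The relation pairs `s` with all configurations within runs resulting in `code s`. The initial
-- configuration, whose tape is not yet set up, is added by hand.
include hstart hcd hQ in
theorem branchingBisimilar_searchRTM {T : LTS Act S} {code : S → ℕ} (hcode : code T.init = n₀)
    (htrans : ∀ s a t, T.trans s a t →
      ∀ K, ∃ k, K ≤ k ∧ test (lab a) (code s) k = true ∧ target k = code t)
    (htrans' : ∀ s a k, test (lab a) (code s) k = true → ∃ t, T.trans s a t ∧ target k = code t)
    (hfinal : ∀ s ∈ T.final, ∀ K, ∃ k, K ≤ k ∧ test none (code s) k = true)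
    (hfinal' : ∀ s k, test none (code s) k = true → s ∈ T.final) :
    T.BranchingBisimilar (searchRTM lab start).lts := by
  have hboot : Within lab start n₀ test n₀ (sconf lab start .boot true (start .boot)
      ((Tape.mk₁ []).write (true, fun _ => none))) := within_start .boot represents_nil true
  have hinit : (searchRTM lab start).lts.trans (searchRTM lab start).lts.init none
      (sconf lab start .boot true (start .boot)
        ((Tape.mk₁ []).write (true, fun _ => none))) := trans_init
  have hcheck : ∀ s c, (s = T.init ∧ c = (searchRTM lab start).lts.init) ∨
      Within lab start n₀ test (code s) c →
      ∃ K, ∀ k, K ≤ k → ∀ l, ∃ (q : Q) (T : Tape Sym), q.1 = haltCtl (test l (code s) k) ∧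
        Represents [enc (code s) k] T ∧
        (searchRTM lab start).lts.TauSteps c (sconf lab start (.check l) false q T) ∧
        Within lab start n₀ test (code s) (sconf lab start (.check l) false q T) := by
    rintro s c (⟨rfl, rfl⟩ | h)
    · rw [hcode]
      obtain ⟨K, hK⟩ := exists_tauSteps_check hstart hcd hQ hboot
      refine ⟨K, fun k hk l => ?_⟩
      obtain ⟨q, T, h₁, h₂, h₃, h₄⟩ := hK k hk l
      exact ⟨q, T, h₁, h₂, .head hinit h₃, h₄⟩
    · exact exists_tauSteps_check hstart hcd hQ h
  refine ⟨fun s c => (s = T.init ∧ c = (searchRTM lab start).lts.init) ∨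
    Within lab start n₀ test (code s) c, ⟨?_, ?_, ?_, ?_⟩, .inl ⟨rfl, rfl⟩⟩
  · intro s c h a t ht
    obtain ⟨K, hK⟩ := hcheck s c h
    obtain ⟨k, hk, hk₁, hk₂⟩ := htrans s a t ht K
    obtain ⟨q, U, h₁, h₂, h₃, h₄⟩ := hK k hk (lab a)
    rw [hk₁] at h₁
    refine ⟨_, sconf lab start .go true (start .go) U, h₃, .inl ?_, .inr h₄, .inr ?_⟩
    · exact trans_next h₁ (.inr ⟨rfl, rfl, rfl⟩) U
    · exact hk₂ ▸ within_start (.go _ _) h₂ true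
  · rintro s c (⟨rfl, rfl⟩ | h) a c' hc'
    · obtain ⟨rfl, rfl⟩ := trans_init_cases hc'
      exact ⟨T.init, T.init, .refl, .inr ⟨rfl, rfl⟩, .inl ⟨rfl, rfl⟩, .inr (hcode ▸ hboot)⟩
    · have hc := h
      obtain ⟨p, v, k, b, T₀, r, q, U, hrun, hT₀, hr, rfl⟩ := h
      rcases trans_conf_cases hc' with ⟨rfl, rfl⟩ | ⟨rfl, r', q', U', hm, rfl⟩ |
        ⟨b', p', hq, hnext, rfl⟩
      · exact ⟨s, s, .refl, .inr ⟨rfl, rfl⟩, .inr hc,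
          .inr ⟨p, v, k, b, T₀, false, q, U, hrun, hT₀, hr, rfl⟩⟩
      · exact ⟨s, s, .refl, .inr ⟨rfl, rfl⟩, .inr hc,
          .inr ⟨p, v, k, b, T₀, r', q', U', hrun, hT₀, hr.tail hm, rfl⟩⟩
      · rw [hq] at hr
        obtain ⟨rfl, hU⟩ := represents_of_reaches_halt hstart hcd hrun hT₀ hr
        -- Only the third choice leaves `s`; there the successful test yields an actual transition
        -- of `T`.
        rcases hnext with ⟨rfl, rfl | ⟨l, rfl⟩⟩ | ⟨rfl, rfl, rfl⟩
        · exact ⟨s, s, .refl, .inr ⟨rfl, rfl⟩, .inr hc, .inr (within_start (.inc _ _) hU true)⟩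
        · exact ⟨s, s, .refl, .inr ⟨rfl, rfl⟩, .inr hc,
            .inr (within_start (.check _ _ _) hU true)⟩
        · obtain ⟨t, ht, hk⟩ := htrans' s a k hrun.test_eq
          exact ⟨s, t, .refl, .inl ht, .inr hc, .inr (hk ▸ within_start (.go _ _) hU true)⟩
  · intro s c h hs
    obtain ⟨K, hK⟩ := hcheck s c h
    obtain ⟨k, hk, hk₁⟩ := hfinal s hs K
    obtain ⟨q, U, h₁, h₂, h₃, h₄⟩ := hK k hk none
    rw [hk₁] at h₁
    exact ⟨_, h₃, .inr h₄, _, _, _, rfl, h₁, rfl, rfl⟩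
  · rintro s c (⟨rfl, rfl⟩ | h) hc'
    · obtain ⟨p, q, b, h, -⟩ := hc'
      cases h
    · refine ⟨s, .refl, .inr h, ?_⟩
      obtain ⟨p, v, k, b, T₀, r, q, U, hrun, hT₀, hr, rfl⟩ := h
      obtain ⟨p', q', b', h, hq, rfl, rfl⟩ := hc'
      cases h
      rw [hq] at hr
      obtain ⟨rfl, hU⟩ := represents_of_reaches_halt hstart hcd hrun hT₀ hr
      exact hfinal' s k hrun.test_eq

end

theorem exists_finite_support_range {P : Type} [Finite P] (cd : P → ToPartrec.Code) :
    ∃ Q : Set Ctl, Q.Finite ∧ (∀ p, startCtl (cd p) ∈ Q) ∧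
      ∀ q a q' s, machine q a = some (q', s) → q ∈ Q → q' ∈ Q := by
  choose Q hfin hstart hQ using fun p => exists_finite_support (cd p)
  refine ⟨⋃ p, Q p, Set.finite_iUnion hfin, fun p => Set.mem_iUnion.2 ⟨p, hstart p⟩, ?_⟩
  intro q a q' s h hq
  obtain ⟨p, hp⟩ := Set.mem_iUnion.1 hq
  exact Set.mem_iUnion.2 ⟨p, hQ p _ _ _ _ h hp⟩

end ReactiveTM

/-- There is a finite set of data symbols over which every effective transition system, with
any finite set of action symbols, is branching bisimilar to the transition system of some
reactive Turing machine. -/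
theorem mainTheorem2 :
    ∃ (D : Type) (_ : Finite D),
      ∀ (Act : Type*) [Finite Act] (S : Type*) (T : ReactiveTM.LTS Act S),
        T.Effective →
          ∃ M : ReactiveTM.RTM Act D, T.BranchingBisimilar M.lts := by
  refine ⟨ReactiveTM.Sym, inferInstance, fun Act _ S T hT => ?_⟩
  obtain ⟨codeAct, code, hAct, hcode, htrans, hfinal⟩ := hT
  -- `Act` may live in any universe, while control states must form a `Type`, so phases refer to
  -- labels through `Fin m`.
  obtain ⟨m, ⟨e⟩⟩ := Finite.exists_equiv_fin Act
  obtain ⟨f, hf, hf'⟩ := ReactiveTM.exists_primrec_of_rePred htrans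
  obtain ⟨g, hg, hg'⟩ := ReactiveTM.exists_primrec_of_rePred hfinal
  have htarget : Primrec ReactiveTM.target :=
    Primrec.fst.comp (Primrec.unpair.comp (Primrec.snd.comp Primrec.unpair))
  have hwitness : Primrec ReactiveTM.witness :=
    Primrec.snd.comp (Primrec.unpair.comp (Primrec.snd.comp Primrec.unpair))
  let test : Option (Option (Fin m)) → ℕ → ℕ → Bool := fun l n k => match l with
    | none => g n (ReactiveTM.witness k)
    | some a => f (n, codeAct (a.map e.symm), ReactiveTM.target k) (ReactiveTM.witness k)
  have htest : ∀ l, Primrec₂ (test l) := by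
    rintro (_ | a)
    · exact hg.comp Primrec.fst (hwitness.comp Primrec.snd)
    · exact hf.comp (Primrec.fst.pair ((Primrec.const _).pair (htarget.comp Primrec.snd)))
        (hwitness.comp Primrec.snd)
  let lab : Option Act → Option (Option (Fin m)) := fun a => some (a.map e)
  have hlab : ∀ a n k, test (lab a) n k =
      f (n, codeAct a, ReactiveTM.target k) (ReactiveTM.witness k) := by
    intro a n k
    simp [test, lab]
  obtain ⟨cd, hcd⟩ := ReactiveTM.exists_codes (code T.init) htest
  obtain ⟨Q, hfin, hstart, hQ⟩ := ReactiveTM.exists_finite_support_range cd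
  have := hfin.to_subtype
  refine ⟨ReactiveTM.searchRTM lab fun p => (⟨_, hstart p⟩ : Q),
    ReactiveTM.branchingBisimilar_searchRTM (code := code) (fun _ => rfl) hcd hQ rfl ?_ ?_ ?_ ?_⟩
  · intro s a t hst K
    obtain ⟨w, hw⟩ := (hf' (code s, codeAct a, code t)).1 ⟨s, a, t, hst, rfl⟩
    obtain ⟨k, hk, hk₁, hk₂⟩ := ReactiveTM.exists_candidate (code t) w K
    exact ⟨k, hk, by rw [hlab, hk₁, hk₂, hw], hk₁⟩
  · intro s a k h
    rw [hlab] at h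
    obtain ⟨s', a', t, hst, heq⟩ := (hf' _).2 ⟨_, h⟩
    simp only [Prod.mk.injEq] at heq
    obtain ⟨h₁, h₂, h₃⟩ := heq
    obtain rfl := hcode h₁
    obtain rfl := hAct h₂
    exact ⟨t, hst, h₃⟩
  · intro s hs K
    obtain ⟨w, hw⟩ := (hg' (code s)).1 ⟨s, hs, rfl⟩
    -- The finality test ignores the target, so `0` is arbitrary.
    obtain ⟨k, hk, -, hk₂⟩ := ReactiveTM.exists_candidate 0 w K
    exact ⟨k, hk, by simp only [test, hk₂, hw]⟩
  · intro s k h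
    obtain ⟨s', hs', heq⟩ := (hg' _).2 ⟨_, h⟩
    exact hcode heq ▸ hs'
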